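/- **Notation.** Let $\mathbf Q\subset\mathbb R^n$ be a finite set of nonzero vectors and $\phi_*\in\mathbb C^n$. $\mathbf Q$ is *projective* if some $\delta\in\mathbb R^n$ satisfies $Q\cdot\delta>0$ for all $Q\in\mathbf Q$. A vector $\eta\in\mathbb R^n$ is *generic* for $\mathbf Q$ if it lies in the span of no $n-1$ elements of $\mathbf Q$. Let $\hat R_{\mathbf Q,\phi_*}$ be the ring of fractions $f/\prod_{Q\in\mathbf Q}(Q\cdot(\phi-\phi_*))^{m_Q}$ with $m_Q\in\mathbb N$ and $f$ a formal power series in $\phi_1-\phi_{*1},\dots,\phi_n-\phi_{*n}$, and let $\hat R_{\mathbf Q,\phi_*}[-n]$ be its part of degree $-n$. For $\sigma=\{Q_1,\dots,Q_n\}\subset\mathbf Q$ a basis of $\mathbb R^n$ put $f_\sigma=\prod_{i}(Q_i\cdot(\phi-\phi_*))^{-1}$ and $\mathrm{Cone}(\sigma)=\{\sum_i a_iQ_i : a_i>0\}$. Let $S$ be the span of the $f_\sigma$, and $NS$ the span of the degree $-n$ fractions $\psi/\prod_{Q\in\kappa}(Q\cdot(\phi-\phi_*))^{\nu_Q}$ with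 $\psi$ a polynomial, $\nu_Q\in\mathbb N$ and $\kappa\subset\mathbf Q$ containing no basis of $\mathbb R^n$; then $\hat R_{\mathbf Q,\phi_*}[-n]=S\oplus NS$. For $\mathbf Q$ projective and $\eta$ generic, the Jeffrey–Kirwan residue $\hat R_{\mathbf Q,\phi_*}\to\mathbb C$ is the composite of the projection to degree $-n$, the projection to $S$ along $NS$, and the (well-defined) linear functional on $S$ that sends $f_\sigma$ to $|\det(Q_1,\dots,Q_n)|^{-1}$ if $\eta\in\mathrm{Cone}(\sigma)$ and to $0$ otherwise. **Setting.** Let $W\subset O(n)$ be a Weyl group (or, more generally, any subgroup of $O(n)$), acting on $\mathbb R^n$ and, by complexification, on $\mathbb C^n$. Let $\mathcal Z$ be a rational function on $\mathbb C^n$ with $\mathcal Z(g\phi)=\mathcal Z(\phi)$ for all $g\in W$, of the form $\mathcal Z=p/\prod_{\ell\in A}\ell^{m_\ell}$ with $p$ a polynomial, $m_\ell\in\mathbb N$, and $A$ a finite set of affine forms $\ell(\phi)=Q_\ell\cdot\phi+c_\ell$ ($Q_\ell\in\mathbb R^n\setminus\{0\}$, $c_\ell\in\mathbb C$) with pairwise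 distinct zero hyperplanes. Assume that the chosen forms are $W$-equivariant up to positive factors: for $g\in W$ and $\ell\in A$ there is $t>0$ such that $t\,\bigl((gQ_\ell)\cdot\phi+c_\ell\bigr)$ belongs to $A$. For $\phi_*\in\mathbb C^n$ put $\mathbf Q_*(\phi_*)=\{Q_\ell:\ell\in A,\ \ell(\phi_*)=0\}$, and let $\mathrm{JK\text{-}Res}_{\eta,\phi_*}\mathcal Z$ be the Jeffrey–Kirwan residue, for $\mathbf Q=\mathbf Q_*(\phi_*)$, of the expansion of $\mathcal Z$ at $\phi_*$. **Proposition.** Let $\phi_*\in\mathbb C^n$ be such that $\mathbf Q_*(\phi_*)$ is projective, and let $\eta\in\mathbb R^n$ be generic for $\mathbf Q_*(\phi_*)$. Then for every $g\in W$ $$\mathrm{JK\text{-}Res}_{g\cdot\eta,\,g\cdot\phi_*}\mathcal Z=\mathrm{JK\text{-}Res}_{\eta,\,\phi_*}\mathcal Z .$$ -/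

import Mathlib

namespace JK

open scoped Matrix

noncomputable section

/-- Rational functions of `n` complex variables `φ₁, …, φₙ`. -/
abbrev RatFun (n : ℕ) : Type := FractionRing (MvPolynomial (Fin n) ℂ)

/-- The field in which the local computations at a point `φ⋆` take place: fractions of formal power
series in `n` variables, where the variable `X j` stands for `φ j - φ⋆ j`. -/
abbrev LocalField (n : ℕ) : Type := FractionRing (MvPowerSeries (Fin n) ℂ)

variable {n : ℕ}

/-! ### The action of orthogonal matrices -/

/-- The action of `O(n)` on `ℝⁿ`. -/
def actReal (g : Matrix.orthogonalGroup (Fin n) ℝ) (v : Fin n → ℝ) : Fin n → ℝ :=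
  (g : Matrix (Fin n) (Fin n) ℝ) *ᵥ v

/-- The (complexified) action of `O(n)` on `ℂⁿ`. -/
def actComplex (g : Matrix.orthogonalGroup (Fin n) ℝ) (φ : Fin n → ℂ) : Fin n → ℂ :=
  (g : Matrix (Fin n) (Fin n) ℝ).map Complex.ofReal *ᵥ φ

/-- The linear substitution `p(φ) ↦ p(M φ)` on polynomials. -/
def polySubst (M : Matrix (Fin n) (Fin n) ℝ) :
    MvPolynomial (Fin n) ℂ →ₐ[ℂ] MvPolynomial (Fin n) ℂ :=
  MvPolynomial.aeval fun j => ∑ k, MvPolynomial.C (M j k : ℂ) * MvPolynomial.X k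

theorem polySubst_comp (M N : Matrix (Fin n) (Fin n) ℝ) :
    (polySubst M).comp (polySubst N) = polySubst (N * M) := by
  apply MvPolynomial.algHom_ext
  intro j
  simp only [polySubst, AlgHom.comp_apply, MvPolynomial.aeval_X, map_sum, map_mul,
    MvPolynomial.algHom_C, MvPolynomial.algebraMap_eq, Matrix.mul_apply, Complex.ofReal_sum,
    Complex.ofReal_mul, Finset.mul_sum, Finset.sum_mul, mul_assoc]
  rw [Finset.sum_comm]

theorem polySubst_one :
    polySubst (1 : Matrix (Fin n) (Fin n) ℝ) = AlgHom.id ℂ (MvPolynomial (Fin n) ℂ) := by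
  apply MvPolynomial.algHom_ext
  intro j
  simp [polySubst, Matrix.one_apply, apply_ite]

/-- For orthogonal `g`, the substitution `p(φ) ↦ p(g φ)` as an automorphism of polynomials. -/
def polySubstEquiv (g : Matrix.orthogonalGroup (Fin n) ℝ) :
    MvPolynomial (Fin n) ℂ ≃ₐ[ℂ] MvPolynomial (Fin n) ℂ :=
  AlgEquiv.ofAlgHom (polySubst (g : Matrix (Fin n) (Fin n) ℝ))
    (polySubst ((g⁻¹ : Matrix.orthogonalGroup (Fin n) ℝ) : Matrix (Fin n) (Fin n) ℝ))
    (by rw [polySubst_comp, ← Submonoid.coe_mul, inv_mul_cancel]; exact polySubst_one)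
    (by rw [polySubst_comp, ← Submonoid.coe_mul, mul_inv_cancel]; exact polySubst_one)

/-- The substitution `Z(φ) ↦ Z(g φ)` on rational functions. -/
def precomp (g : Matrix.orthogonalGroup (Fin n) ℝ) : RatFun n ≃+* RatFun n :=
  IsFractionRing.ringEquivOfRingEquiv (polySubstEquiv g).toRingEquiv

/-! ### Expansion of a rational function at a point -/

/-- A polynomial in the local variables, as an element of the local field. -/
def ofPoly : MvPolynomial (Fin n) ℂ →+* LocalField n :=
  (algebraMap (MvPowerSeries (Fin n) ℂ) (LocalField n)).comp
    MvPolynomial.coeToMvPowerSeries.ringHom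

/-- The polynomial `p(φ⋆ + X)` in `X = φ - φ⋆`. -/
def translate (φ : Fin n → ℂ) : MvPolynomial (Fin n) ℂ →ₐ[ℂ] MvPolynomial (Fin n) ℂ :=
  MvPolynomial.aeval fun j => MvPolynomial.C (φ j) + MvPolynomial.X j

theorem ofPoly_comp_translate_injective (φ : Fin n → ℂ) :
    Function.Injective (ofPoly.comp (translate φ).toRingHom) := by
  have h1 : Function.Injective (translate φ) := by
    apply Function.LeftInverse.injective (g := translate (-φ))
    intro p
    have : (translate (-φ)).comp (translate φ) = AlgHom.id ℂ _ := by
      apply MvPolynomial.algHom_ext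
      intro j
      simp [translate]
    exact DFunLike.congr_fun this p
  have h2 : Function.Injective (ofPoly (n := n)) :=
    (IsFractionRing.injective (MvPowerSeries (Fin n) ℂ) (LocalField n)).comp
      (MvPolynomial.coe_injective (Fin n) ℂ)
  exact h2.comp h1

/-- The expansion of a rational function at the point `φ`, in the local variables `X j`. -/
def expandAt (φ : Fin n → ℂ) : RatFun n →+* LocalField n :=
  IsFractionRing.lift (ofPoly_comp_translate_injective φ)

/-! ### The Jeffrey–Kirwan residue attached to a finite set of vectors -/

/-- The linear form `Q · (φ - φ⋆)`, as an element of the local field. -/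
def linForm (Q : Fin n → ℝ) : LocalField n :=
  ofPoly (∑ j, MvPolynomial.C (Q j : ℂ) * MvPolynomial.X j)

/-- `Qs` is projective: some vector has positive inner product with all its elements. -/
def Projective (Qs : Finset (Fin n → ℝ)) : Prop :=
  ∃ δ : Fin n → ℝ, ∀ Q ∈ Qs, 0 < Q ⬝ᵥ δ

/-- `η` is generic with respect to `Qs`: it does not lie in the span of any `n - 1` elements. -/
def Generic (Qs : Finset (Fin n → ℝ)) (η : Fin n → ℝ) : Prop :=
  ∀ T ⊆ Qs, T.card + 1 = n → η ∉ Submodule.span ℝ (T : Set (Fin n → ℝ))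

open Classical in
/-- The (ordered) bases of `ℝⁿ` consisting of elements of `Qs`. -/
def bases (Qs : Finset (Fin n → ℝ)) : Finset (Fin n → Fin n → ℝ) :=
  (Fintype.piFinset fun _ => Qs).filter fun σ => LinearIndependent ℝ σ

/-- The basic fraction `f_σ = 1 / ∏ Q · (φ - φ⋆)`, the product being over the elements `Q` of the
basis `σ`. -/
def basicFraction (σ : Fin n → Fin n → ℝ) : LocalField n := (∏ i, linForm (σ i))⁻¹

/-- The open cone of positive combinations of `σ`. -/
def cone (σ : Fin n → Fin n → ℝ) : Set (Fin n → ℝ) :=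
  {v | ∃ a : Fin n → ℝ, (∀ i, 0 < a i) ∧ v = ∑ i, a i • σ i}

open Classical in
/-- The Jeffrey–Kirwan residue of the basic fraction `f_σ`. -/
def basicResidue (η : Fin n → ℝ) (σ : Fin n → Fin n → ℝ) : ℂ :=
  if η ∈ cone σ then ((|(Matrix.of σ).det|⁻¹ : ℝ) : ℂ) else 0

/-- The space `NS`: the span of the degree `-n` fractions `ψ / ∏_{Q ∈ κ} (Q · (φ - φ⋆)) ^ ν Q` with
`ψ` a (homogeneous) polynomial and `κ ⊆ Qs` a subset that contains no basis of `ℝⁿ`. -/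
def NS (Qs : Finset (Fin n → ℝ)) : Submodule ℂ (LocalField n) :=
  Submodule.span ℂ {F | ∃ κ ⊆ Qs, bases κ = ∅ ∧
    ∃ (ν : (Fin n → ℝ) → ℕ) (d : ℕ) (ψ : MvPolynomial (Fin n) ℂ),
      ψ.IsHomogeneous d ∧ (d : ℤ) - ∑ Q ∈ κ, (ν Q : ℤ) = -(n : ℤ) ∧
      F = ofPoly ψ / ∏ Q ∈ κ, linForm Q ^ ν Q}

/-- `F` is an element `f / ∏_{Q ∈ Qs} (Q · (φ - φ⋆)) ^ m Q` of the ring obtained from formal power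
series by inverting the linear forms of `Qs`, and `G` is its homogeneous part of degree `d`. -/
def IsDegreePart (Qs : Finset (Fin n → ℝ)) (d : ℤ) (F G : LocalField n) : Prop :=
  ∃ (f : MvPowerSeries (Fin n) ℂ) (m : (Fin n → ℝ) → ℕ) (k : MvPowerSeries (Fin n) ℂ),
    F = algebraMap _ (LocalField n) f / ∏ Q ∈ Qs, linForm Q ^ m Q ∧
    (∀ e : Fin n →₀ ℕ, MvPowerSeries.coeff e k =
      if (e.degree : ℤ) = d + ∑ Q ∈ Qs, (m Q : ℤ) then MvPowerSeries.coeff e f else 0) ∧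
    G = algebraMap _ (LocalField n) k / ∏ Q ∈ Qs, linForm Q ^ m Q

/-- `c` is the value obtained from `F` by projecting to degree `-n`, writing the result as a linear
combination of basic fractions plus an element of `NS`, and replacing every basic fraction by its
residue. -/
def IsResidue (Qs : Finset (Fin n → ℝ)) (η : Fin n → ℝ) (F : LocalField n) (c : ℂ) : Prop :=
  ∃ (G : LocalField n) (a : (Fin n → Fin n → ℝ) → ℂ),
    IsDegreePart Qs (-(n : ℤ)) F G ∧
    G - ∑ σ ∈ bases Qs, a σ • basicFraction σ ∈ NS Qs ∧
    c = ∑ σ ∈ bases Qs, a σ * basicResidue η σ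

open Classical in
/-- The Jeffrey–Kirwan residue of `F`. For projective `Qs`, generic `η` and `F` in the ring obtained
by inverting the linear forms of `Qs`, there is exactly one `c` with `IsResidue Qs η F c`. -/
def residue (Qs : Finset (Fin n → ℝ)) (η : Fin n → ℝ) (F : LocalField n) : ℂ :=
  if h : ∃ c, IsResidue Qs η F c then h.choose else 0

/-! ### Rational functions whose denominator is a product of affine forms -/

/-- The polynomial `Q · φ + c` attached to a pair `(Q, c)`. -/
def affineForm (l : (Fin n → ℝ) × ℂ) : MvPolynomial (Fin n) ℂ :=
  ∑ j, MvPolynomial.C (l.1 j : ℂ) * MvPolynomial.X j + MvPolynomial.C l.2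

/-- The hyperplane `Q · φ + c = 0` in `ℂⁿ` attached to a pair `(Q, c)`. -/
def hyperplane (l : (Fin n → ℝ) × ℂ) : Set (Fin n → ℂ) :=
  {φ | ∑ j, (l.1 j : ℂ) * φ j + l.2 = 0}

/-- `Z` can be written with a denominator that is a product of powers of the affine forms in `A`,
which have nonzero real coefficient vectors and define pairwise distinct hyperplanes. -/
structure Factorizes (A : Finset ((Fin n → ℝ) × ℂ)) (Z : RatFun n) : Prop where
  ne_zero : ∀ l ∈ A, l.1 ≠ 0
  distinct : Set.InjOn hyperplane (A : Set ((Fin n → ℝ) × ℂ))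
  eq_div : ∃ (p : MvPolynomial (Fin n) ℂ) (m : (Fin n → ℝ) × ℂ → ℕ),
    Z = algebraMap _ (RatFun n) p / ∏ l ∈ A, algebraMap _ (RatFun n) (affineForm l) ^ m l

/-- Every `g ∈ W` maps the hyperplanes of `A` to hyperplanes of `A`, and the chosen coefficient
vectors to the chosen ones, up to positive factors (so orientations are respected). Here `g` maps the
hyperplane `Q · φ + c = 0` to `(g Q) · φ + c = 0`. -/
def Equivariant (W : Subgroup (Matrix.orthogonalGroup (Fin n) ℝ))
    (A : Finset ((Fin n → ℝ) × ℂ)) : Prop :=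
  ∀ g ∈ W, ∀ l ∈ A, ∃ t : ℝ, 0 < t ∧ (t • actReal g l.1, (t : ℂ) * l.2) ∈ A

open Classical in
/-- The set `Q⋆(φ)` of coefficient vectors of the hyperplanes of `A` that contain `φ`. -/
def vectorsAt (A : Finset ((Fin n → ℝ) × ℂ)) (φ : Fin n → ℂ) : Finset (Fin n → ℝ) :=
  (A.filter fun l => φ ∈ hyperplane l).image Prod.fst

/-- The Jeffrey–Kirwan residue of `Z` at the point `φ` with respect to the vector `η`. -/
def JKRes (A : Finset ((Fin n → ℝ) × ℂ)) (η : Fin n → ℝ) (φ : Fin n → ℂ) (Z : RatFun n) : ℂ :=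
  residue (vectorsAt A φ) η (expandAt φ Z)

end

end JK

/-!
The proof is transport of structure. Let `g ∈ W`. The substitution `X ↦ g⁻¹X` of the local variables
extends to the field of fractions of power series (`localAct g`), and since `Z(gφ) = Z(φ)` it takes
the expansion of `Z` at `φ` to the expansion at `gφ` (`expandAt_actComplex`). As `g` is orthogonal,
it takes the linear form of `Q` to that of `gQ` (`localAct_linForm`).

Equivariance of the arrangement says that the vectors at `gφ` are the vectors `gQ`, for `Q` a vector
at `φ`, each multiplied by a positive number `t Q`; distinctness of the hyperplanes makes this a
bijection (`exists_vectorsAt_eq_image`). Along it every ingredient of the residue is carried over: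
homogeneous parts, because a linear substitution preserves degrees; the space `NS`; the bases; the
cones, because the factors are positive. A basic fraction `f_σ` becomes `∏ t(σ i)` times the basic
fraction of the moved basis, whereas the residue of the latter is the old one divided by the same
product, because `|det|` is multiplied by `∏ t(σ i)` and `|det g| = 1`. So a decomposition of the
degree `-n` part at `φ` gives one at `gφ` with the same value (`IsResidue.localAct`). With `g⁻¹` in
place of `g` the converse follows: the values computed from the decompositions at `φ` and at `gφ`
are exactly the same, hence so are the residues.
-/

namespace JK

open scoped Matrix

noncomputable section

variable {n : ℕ}

/-! ### Linear substitutions of power series -/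

/-- The linear form `∑ₖ M j k Xₖ`, as a power series. -/
def rowSeries (M : Matrix (Fin n) (Fin n) ℝ) (j : Fin n) : MvPowerSeries (Fin n) ℂ :=
  (↑(∑ k, MvPolynomial.C (M j k : ℂ) * MvPolynomial.X k : MvPolynomial (Fin n) ℂ) :
    MvPowerSeries (Fin n) ℂ)

theorem isHomogeneous_row (M : Matrix (Fin n) (Fin n) ℝ) (j : Fin n) :
    (∑ k, MvPolynomial.C (M j k : ℂ) * MvPolynomial.X k :
      MvPolynomial (Fin n) ℂ).IsHomogeneous 1 :=
  MvPolynomial.IsHomogeneous.sum _ _ _ fun k _ => by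
    simpa using (MvPolynomial.isHomogeneous_C (Fin n) (M j k : ℂ)).mul
      (MvPolynomial.isHomogeneous_X ℂ k)

theorem hasSubst_rowSeries (M : Matrix (Fin n) (Fin n) ℝ) :
    MvPowerSeries.HasSubst (rowSeries M) := by
  refine MvPowerSeries.hasSubst_of_constantCoeff_zero fun j => ?_
  rw [← MvPowerSeries.coeff_zero_eq_constantCoeff_apply, rowSeries, MvPolynomial.coeff_coe]
  exact (isHomogeneous_row M j).coeff_eq_zero (by simp)

/-- The linear substitution `f(X) ↦ f(M X)` on power series. -/
def seriesSubst (M : Matrix (Fin n) (Fin n) ℝ) :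
    MvPowerSeries (Fin n) ℂ →ₐ[ℂ] MvPowerSeries (Fin n) ℂ :=
  MvPowerSeries.substAlgHom (hasSubst_rowSeries M)

theorem seriesSubst_coe (M : Matrix (Fin n) (Fin n) ℝ) (p : MvPolynomial (Fin n) ℂ) :
    seriesSubst M (p : MvPowerSeries (Fin n) ℂ) = (polySubst M p : MvPolynomial (Fin n) ℂ) := by
  have h : (MvPolynomial.aeval (rowSeries M)) =
      (MvPolynomial.coeToMvPowerSeries.algHom ℂ).comp (polySubst M) := by
    apply MvPolynomial.algHom_ext
    intro j
    rw [MvPolynomial.aeval_X, AlgHom.comp_apply, polySubst, MvPolynomial.aeval_X,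
      MvPolynomial.coeToMvPowerSeries.algHom_apply, Algebra.algebraMap_self,
      MvPowerSeries.map_id, RingHom.id_apply, rowSeries]
  rw [seriesSubst, MvPowerSeries.substAlgHom_coe, h]
  simp

/-- Linear substitutions preserve homogeneous parts: if `k` is the part of degree `D` of `f`, then
`k(M X)` is the part of degree `D` of `f(M X)`. -/
theorem coeff_seriesSubst_of_homogeneousPart (M : Matrix (Fin n) (Fin n) ℝ) {D : ℤ}
    {f k : MvPowerSeries (Fin n) ℂ}
    (h : ∀ e : Fin n →₀ ℕ, MvPowerSeries.coeff e k =
      if (e.degree : ℤ) = D then MvPowerSeries.coeff e f else 0) (e : Fin n →₀ ℕ) :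
    MvPowerSeries.coeff e (seriesSubst M k) =
      if (e.degree : ℤ) = D then MvPowerSeries.coeff e (seriesSubst M f) else 0 := by
  have key : ∀ d : Fin n →₀ ℕ, d.degree ≠ e.degree →
      MvPowerSeries.coeff e (d.prod fun s m => rowSeries M s ^ m) = 0 := by
    intro d hd
    have hp : (d.prod fun s m => rowSeries M s ^ m) =
        ((d.prod fun s m => (∑ k, MvPolynomial.C (M s k : ℂ) * MvPolynomial.X k) ^ m :
          MvPolynomial (Fin n) ℂ) : MvPowerSeries (Fin n) ℂ) := by
      simp only [Finsupp.prod, rowSeries, ← MvPolynomial.coeToMvPowerSeries.ringHom_apply,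
        map_prod, map_pow]
    have hh : (d.prod fun s m => (∑ k, MvPolynomial.C (M s k : ℂ) * MvPolynomial.X k) ^ m :
          MvPolynomial (Fin n) ℂ).IsHomogeneous d.degree := by
      refine MvPolynomial.IsHomogeneous.prod _ _ _ fun i _ => ?_
      simpa using (isHomogeneous_row M i).pow (d i)
    rw [hp, MvPolynomial.coeff_coe]
    exact hh.coeff_eq_zero (Ne.symm hd)
  simp only [seriesSubst, MvPowerSeries.substAlgHom_apply,
    MvPowerSeries.coeff_subst (hasSubst_rowSeries M)]
  split_ifs with he
  · refine finsum_congr fun d => ?_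
    by_cases hd : d.degree = e.degree
    · rw [h, if_pos (by rw [hd, he])]
    · rw [key d hd, smul_zero, smul_zero]
  · refine finsum_eq_zero_of_forall_eq_zero fun d => ?_
    by_cases hd : d.degree = e.degree
    · rw [h, if_neg (by rwa [hd]), zero_smul]
    · rw [key d hd, smul_zero]

theorem seriesSubst_comp_apply (M N : Matrix (Fin n) (Fin n) ℝ) (f : MvPowerSeries (Fin n) ℂ) :
    seriesSubst M (seriesSubst N f) = seriesSubst (N * M) f := by
  have h : (fun j => MvPowerSeries.subst (rowSeries M) (rowSeries N j)) = rowSeries (N * M) := by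
    funext j
    have h1 := seriesSubst_coe M (polySubst N (MvPolynomial.X j))
    rw [← AlgHom.comp_apply, polySubst_comp] at h1
    simpa [polySubst, rowSeries, seriesSubst] using h1
  simp only [seriesSubst, MvPowerSeries.substAlgHom_apply]
  rw [MvPowerSeries.subst_comp_subst_apply (hasSubst_rowSeries N) (hasSubst_rowSeries M), h]

theorem seriesSubst_one_apply (f : MvPowerSeries (Fin n) ℂ) :
    seriesSubst (1 : Matrix (Fin n) (Fin n) ℝ) f = f := by
  have h : rowSeries (1 : Matrix (Fin n) (Fin n) ℝ) = MvPowerSeries.X := by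
    funext j
    simp [rowSeries, Matrix.one_apply, apply_ite]
  rw [seriesSubst, MvPowerSeries.substAlgHom_apply, h, MvPowerSeries.subst_self, id]

theorem seriesSubst_injective (g : Matrix.orthogonalGroup (Fin n) ℝ) :
    Function.Injective (seriesSubst (g : Matrix (Fin n) (Fin n) ℝ)) := by
  refine Function.LeftInverse.injective (g := seriesSubst
    ((g⁻¹ : Matrix.orthogonalGroup (Fin n) ℝ) : Matrix (Fin n) (Fin n) ℝ)) fun f => ?_
  rw [seriesSubst_comp_apply, ← Submonoid.coe_mul, mul_inv_cancel]
  exact seriesSubst_one_apply f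

theorem algebraMap_comp_seriesSubst_injective (g : Matrix.orthogonalGroup (Fin n) ℝ) :
    Function.Injective ((IsScalarTower.toAlgHom ℂ (MvPowerSeries (Fin n) ℂ) (LocalField n)).comp
      (seriesSubst (g : Matrix (Fin n) (Fin n) ℝ))) :=
  (IsFractionRing.injective (MvPowerSeries (Fin n) ℂ) (LocalField n)).comp
    (seriesSubst_injective g)

/-- The map `F(X) ↦ F(g⁻¹ X)` on the local field. -/
def localAct (g : Matrix.orthogonalGroup (Fin n) ℝ) : LocalField n →ₐ[ℂ] LocalField n :=
  IsFractionRing.liftAlgHom (algebraMap_comp_seriesSubst_injective g⁻¹)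

theorem localAct_algebraMap (g : Matrix.orthogonalGroup (Fin n) ℝ)
    (f : MvPowerSeries (Fin n) ℂ) :
    localAct g (algebraMap _ (LocalField n) f) = algebraMap _ (LocalField n)
      (seriesSubst ((g⁻¹ : Matrix.orthogonalGroup (Fin n) ℝ) : Matrix (Fin n) (Fin n) ℝ) f) := by
  rw [localAct, IsFractionRing.liftAlgHom_apply, IsFractionRing.lift_algebraMap]
  rfl

theorem localAct_ofPoly (g : Matrix.orthogonalGroup (Fin n) ℝ) (p : MvPolynomial (Fin n) ℂ) :
    localAct g (ofPoly p) = ofPoly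
      (polySubst ((g⁻¹ : Matrix.orthogonalGroup (Fin n) ℝ) : Matrix (Fin n) (Fin n) ℝ) p) := by
  simp only [ofPoly, RingHom.comp_apply, localAct_algebraMap,
    MvPolynomial.coeToMvPowerSeries.ringHom_apply, seriesSubst_coe]

theorem coe_inv_eq_transpose (g : Matrix.orthogonalGroup (Fin n) ℝ) :
    ((g⁻¹ : Matrix.orthogonalGroup (Fin n) ℝ) : Matrix (Fin n) (Fin n) ℝ) =
      (g : Matrix (Fin n) (Fin n) ℝ)ᵀ := rfl

/-- Orthogonality enters here: `Q · g⁻¹X = gQ · X`. -/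
theorem localAct_linForm (g : Matrix.orthogonalGroup (Fin n) ℝ) (Q : Fin n → ℝ) :
    localAct g (linForm Q) = linForm (actReal g Q) := by
  rw [linForm, linForm, localAct_ofPoly]
  congr 1
  simp only [map_sum, map_mul, polySubst, MvPolynomial.aeval_X, MvPolynomial.algHom_C,
    MvPolynomial.algebraMap_eq, coe_inv_eq_transpose, Matrix.transpose_apply, actReal,
    Matrix.mulVec, dotProduct, Complex.ofReal_sum, Complex.ofReal_mul, Finset.mul_sum,
    Finset.sum_mul]
  rw [Finset.sum_comm]
  exact Finset.sum_congr rfl fun _ _ => Finset.sum_congr rfl fun _ _ => by ring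

theorem ofPoly_smul (c : ℂ) (p : MvPolynomial (Fin n) ℂ) : ofPoly (c • p) = c • ofPoly p := by
  rw [ofPoly, RingHom.comp_apply, RingHom.comp_apply,
    MvPolynomial.coeToMvPowerSeries.ringHom_apply, MvPolynomial.coe_smul,
    MvPolynomial.coeToMvPowerSeries.ringHom_apply]
  exact (IsScalarTower.toAlgHom ℂ (MvPowerSeries (Fin n) ℂ) (LocalField n)).toLinearMap.map_smul c _

theorem linForm_smul (t : ℝ) (Q : Fin n → ℝ) : linForm (t • Q) = (t : ℂ) • linForm Q := by
  rw [linForm, linForm, ← ofPoly_smul]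
  simp [Finset.smul_sum, MvPolynomial.smul_eq_C_mul, mul_assoc]

/-- Expanding at `gφ` is expanding `Z(g ·)` at `φ`, followed by the substitution `X ↦ g⁻¹X` of the
local variables. -/
theorem expandAt_actComplex (g : Matrix.orthogonalGroup (Fin n) ℝ) (φ : Fin n → ℂ)
    (Z : RatFun n) :
    expandAt (actComplex g φ) Z = localAct g (expandAt φ (precomp g Z)) := by
  have h : expandAt (actComplex g φ) =
      ((localAct g).toRingHom.comp (expandAt φ)).comp (precomp g).toRingHom := by
    apply IsLocalization.ringHom_ext (nonZeroDivisors (MvPolynomial (Fin n) ℂ))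
    apply RingHom.ext
    intro p
    simp only [RingHom.comp_apply, RingEquiv.toRingHom_eq_coe, RingHom.coe_coe, precomp,
      IsFractionRing.ringEquivOfRingEquiv_algebraMap, expandAt, IsFractionRing.lift_algebraMap,
      AlgHom.toRingHom_eq_coe, localAct_ofPoly]
    congr 1
    have h2 : translate (actComplex g φ) = ((polySubst
        ((g⁻¹ : Matrix.orthogonalGroup (Fin n) ℝ) : Matrix (Fin n) (Fin n) ℝ)).comp
        (translate φ)).comp (polySubst (g : Matrix (Fin n) (Fin n) ℝ)) := by
      apply MvPolynomial.algHom_ext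
      intro j
      have h3 := DFunLike.congr_fun (polySubst_comp
        ((g⁻¹ : Matrix.orthogonalGroup (Fin n) ℝ) : Matrix (Fin n) (Fin n) ℝ)
        (g : Matrix (Fin n) (Fin n) ℝ)) (MvPolynomial.X j)
      rw [← Submonoid.coe_mul, mul_inv_cancel, Submonoid.coe_one, polySubst_one] at h3
      simp only [AlgHom.comp_apply, AlgHom.id_apply] at h3
      rw [translate, MvPolynomial.aeval_X]
      conv_lhs => rw [← h3]
      simp [polySubst, translate, mul_add, Finset.sum_add_distrib, actComplex, Matrix.mulVec,
        dotProduct, MvPolynomial.algHom_C]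
    exact DFunLike.congr_fun h2 p
  rw [h]
  rfl

/-! ### The orthogonal action on vectors, bases and cones -/

theorem actReal_injective (g : Matrix.orthogonalGroup (Fin n) ℝ) :
    Function.Injective (actReal g) := by
  refine Function.LeftInverse.injective (g := actReal g⁻¹) fun v => ?_
  rw [actReal, actReal, Matrix.mulVec_mulVec, ← Submonoid.coe_mul, inv_mul_cancel,
    Submonoid.coe_one, Matrix.one_mulVec]

theorem actReal_mul (g h : Matrix.orthogonalGroup (Fin n) ℝ) (v : Fin n → ℝ) :
    actReal (g * h) v = actReal g (actReal h v) := by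
  rw [actReal, actReal, actReal, Matrix.mulVec_mulVec, Submonoid.coe_mul]

theorem actReal_one (v : Fin n → ℝ) : actReal 1 v = v := by
  rw [actReal, Submonoid.coe_one, Matrix.one_mulVec]

theorem actComplex_inv_actComplex (g : Matrix.orthogonalGroup (Fin n) ℝ) (φ : Fin n → ℂ) :
    actComplex g⁻¹ (actComplex g φ) = φ := by
  have h := congrArg (fun M : Matrix (Fin n) (Fin n) ℝ => M.map Complex.ofReal)
    (congrArg Subtype.val (inv_mul_cancel g))
  have h2 : ((1 : Matrix (Fin n) (Fin n) ℝ).map Complex.ofReal) = 1 := by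
    ext i j
    simp [Matrix.one_apply, apply_ite]
  simp only [Submonoid.coe_mul, Submonoid.coe_one, h2] at h
  have h3 := Matrix.map_mul (L := ((g⁻¹ : Matrix.orthogonalGroup (Fin n) ℝ) :
    Matrix (Fin n) (Fin n) ℝ)) (M := (g : Matrix (Fin n) (Fin n) ℝ)) (f := Complex.ofRealHom)
  rw [actComplex, actComplex, Matrix.mulVec_mulVec]
  change (_ * _) *ᵥ φ = φ
  rw [← Matrix.one_mulVec φ, Matrix.mulVec_mulVec, mul_one, ← h]
  exact congrArg (· *ᵥ φ) h3.symm

/-- The vector `Q` moved by `g` and rescaled by the factor `t Q`. -/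
def scaledAct (g : Matrix.orthogonalGroup (Fin n) ℝ) (t : (Fin n → ℝ) → ℝ) (Q : Fin n → ℝ) :
    Fin n → ℝ :=
  t Q • actReal g Q

theorem linearIndependent_scaledAct_iff (g : Matrix.orthogonalGroup (Fin n) ℝ)
    {t : (Fin n → ℝ) → ℝ} (ht : ∀ Q, 0 < t Q) (σ : Fin n → Fin n → ℝ) :
    LinearIndependent ℝ (fun i => scaledAct g t (σ i)) ↔ LinearIndependent ℝ σ := by
  have h1 : (fun i => scaledAct g t (σ i)) =
      (fun i => Units.mk0 (t (σ i)) (ht _).ne') •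
        ((g : Matrix (Fin n) (Fin n) ℝ).mulVecLin ∘ σ) := by
    funext i
    rfl
  rw [h1, LinearIndependent.units_smul_iff]
  exact LinearMap.linearIndependent_iff _ (LinearMap.ker_eq_bot.2 (actReal_injective g))

theorem actReal_mem_cone_scaledAct_iff (g : Matrix.orthogonalGroup (Fin n) ℝ)
    {t : (Fin n → ℝ) → ℝ} (ht : ∀ Q, 0 < t Q) (σ : Fin n → Fin n → ℝ) (η : Fin n → ℝ) :
    actReal g η ∈ cone (fun i => scaledAct g t (σ i)) ↔ η ∈ cone σ := by
  have hsum : ∀ a : Fin n → ℝ, ∑ i, a i • scaledAct g t (σ i) =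
      actReal g (∑ i, (a i * t (σ i)) • σ i) := by
    intro a
    rw [actReal, Matrix.mulVec_sum]
    exact Finset.sum_congr rfl fun i _ => by
      rw [Matrix.mulVec_smul, scaledAct, smul_smul, actReal]
  constructor
  · rintro ⟨a, ha, h⟩
    rw [hsum] at h
    exact ⟨_, fun i => mul_pos (ha i) (ht _), actReal_injective g h⟩
  · rintro ⟨a, ha, h⟩
    refine ⟨fun i => a i / t (σ i), fun i => div_pos (ha i) (ht _), ?_⟩
    rw [hsum, h]
    simp only [div_mul_cancel₀ _ (ht _).ne']

theorem abs_det_scaledAct (g : Matrix.orthogonalGroup (Fin n) ℝ)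
    {t : (Fin n → ℝ) → ℝ} (ht : ∀ Q, 0 < t Q) (σ : Fin n → Fin n → ℝ) :
    |(Matrix.of fun i => scaledAct g t (σ i)).det| = (∏ i, t (σ i)) * |(Matrix.of σ).det| := by
  have h1 : (Matrix.of fun i => scaledAct g t (σ i)) = Matrix.of fun i j =>
      t (σ i) * (Matrix.of σ * (g : Matrix (Fin n) (Fin n) ℝ)ᵀ) i j := by
    ext i j
    simp [scaledAct, actReal, Matrix.mulVec, dotProduct, Matrix.mul_apply, mul_comm]
  have h2 : |(g : Matrix (Fin n) (Fin n) ℝ).det| = 1 := by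
    have h3 : (g : Matrix (Fin n) (Fin n) ℝ) * (g : Matrix (Fin n) (Fin n) ℝ)ᵀ = 1 :=
      (Matrix.mem_orthogonalGroup_iff (Fin n) ℝ).1 g.2
    have h4 := congrArg Matrix.det h3
    rw [Matrix.det_mul, Matrix.det_transpose, Matrix.det_one, ← abs_mul_abs_self] at h4
    nlinarith [abs_nonneg (g : Matrix (Fin n) (Fin n) ℝ).det]
  rw [h1, Matrix.det_mul_column, Matrix.det_mul, Matrix.det_transpose, abs_mul, abs_mul, h2,
    mul_one, abs_of_pos (Finset.prod_pos fun i _ => ht _)]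

/-- Rescaling the basis by positive factors divides the residue by the same product as it divides
the basic fraction, and the orthogonal map does not change it. -/
theorem basicResidue_scaledAct (g : Matrix.orthogonalGroup (Fin n) ℝ)
    {t : (Fin n → ℝ) → ℝ} (ht : ∀ Q, 0 < t Q) (σ : Fin n → Fin n → ℝ) (η : Fin n → ℝ) :
    (∏ i, (t (σ i) : ℂ)) * basicResidue (actReal g η) (fun i => scaledAct g t (σ i)) =
      basicResidue η σ := by
  have hp : (∏ i, (t (σ i) : ℂ)) ≠ 0 :=
    Finset.prod_ne_zero_iff.2 fun i _ => Complex.ofReal_ne_zero.2 (ht _).ne'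
  rw [basicResidue, basicResidue, abs_det_scaledAct g ht]
  have hcone := actReal_mem_cone_scaledAct_iff g ht σ η
  by_cases h : η ∈ cone σ
  · rw [if_pos h, if_pos (hcone.2 h)]
    push_cast
    rw [mul_inv, mul_inv_cancel_left₀ hp]
  · rw [if_neg h, if_neg (mt hcone.1 h), mul_zero]

theorem linForm_scaledAct (g : Matrix.orthogonalGroup (Fin n) ℝ) (t : (Fin n → ℝ) → ℝ)
    (Q : Fin n → ℝ) : linForm (scaledAct g t Q) = (t Q : ℂ) • localAct g (linForm Q) := by
  rw [scaledAct, linForm_smul, localAct_linForm]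

theorem inv_smul_localField (c : ℂ) (F : LocalField n) : (c • F)⁻¹ = c⁻¹ • F⁻¹ := by
  rw [Algebra.smul_def, Algebra.smul_def, mul_inv, map_inv₀]

theorem localAct_basicFraction (g : Matrix.orthogonalGroup (Fin n) ℝ)
    {t : (Fin n → ℝ) → ℝ} (ht : ∀ Q, 0 < t Q) (σ : Fin n → Fin n → ℝ) :
    localAct g (basicFraction σ) =
      (∏ i, (t (σ i) : ℂ)) • basicFraction (fun i => scaledAct g t (σ i)) := by
  have hp : (∏ i, (t (σ i) : ℂ)) ≠ 0 :=
    Finset.prod_ne_zero_iff.2 fun i _ => Complex.ofReal_ne_zero.2 (ht _).ne'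
  simp only [basicFraction, linForm_scaledAct, map_inv₀, map_prod, Finset.prod_smul]
  rw [inv_smul_localField, smul_smul, mul_inv_cancel₀ hp, one_smul]

/-! ### Transport of the residue along an orthogonal map

Throughout, the vectors of `Qs` are moved by `g` and rescaled by positive factors `t`, and no two
of them become equal. -/

/-- The exponents of a denominator on `Qs` transported to the moved vectors: the exponent at
`scaledAct g t Q` is `m Q`. The values outside the image of `Qs` are irrelevant. -/
def transportExp (g : Matrix.orthogonalGroup (Fin n) ℝ) (t : (Fin n → ℝ) → ℝ)
    (Qs : Finset (Fin n → ℝ)) (m : (Fin n → ℝ) → ℕ) (Q : Fin n → ℝ) : ℕ :=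
  m (Function.invFunOn (scaledAct g t) (Qs : Set (Fin n → ℝ)) Q)

theorem transportExp_scaledAct {g : Matrix.orthogonalGroup (Fin n) ℝ} {t : (Fin n → ℝ) → ℝ}
    {Qs : Finset (Fin n → ℝ)} (hinj : Set.InjOn (scaledAct g t) (Qs : Set (Fin n → ℝ)))
    (m : (Fin n → ℝ) → ℕ) {Q : Fin n → ℝ} (hQ : Q ∈ Qs) :
    transportExp g t Qs m (scaledAct g t Q) = m Q := by
  rw [transportExp, hinj.leftInvOn_invFunOn (Finset.mem_coe.2 hQ)]

open Classical in
theorem sum_transportExp {g : Matrix.orthogonalGroup (Fin n) ℝ} {t : (Fin n → ℝ) → ℝ}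
    {Qs : Finset (Fin n → ℝ)} (hinj : Set.InjOn (scaledAct g t) (Qs : Set (Fin n → ℝ)))
    (m : (Fin n → ℝ) → ℕ) :
    ∑ Q ∈ Qs.image (scaledAct g t), (transportExp g t Qs m Q : ℤ) = ∑ Q ∈ Qs, (m Q : ℤ) := by
  rw [Finset.sum_image hinj]
  exact Finset.sum_congr rfl fun Q hQ => by rw [transportExp_scaledAct hinj m hQ]

open Classical in
theorem prod_linForm_transportExp {g : Matrix.orthogonalGroup (Fin n) ℝ} {t : (Fin n → ℝ) → ℝ}
    {Qs : Finset (Fin n → ℝ)} (hinj : Set.InjOn (scaledAct g t) (Qs : Set (Fin n → ℝ)))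
    (m : (Fin n → ℝ) → ℕ) :
    ∏ Q ∈ Qs.image (scaledAct g t), linForm Q ^ transportExp g t Qs m Q =
      (∏ Q ∈ Qs, (t Q : ℂ) ^ m Q) • localAct g (∏ Q ∈ Qs, linForm Q ^ m Q) := by
  rw [Finset.prod_image hinj, map_prod, ← Finset.prod_smul]
  exact Finset.prod_congr rfl fun Q hQ => by
    rw [transportExp_scaledAct hinj m hQ, linForm_scaledAct, smul_pow, map_pow]

open Classical in
/-- A fraction transported by `g` is a fraction over the moved vectors, once the numerator absorbs
the scaling factors. -/
theorem localAct_div_prod {g : Matrix.orthogonalGroup (Fin n) ℝ} {t : (Fin n → ℝ) → ℝ}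
    (ht : ∀ Q, 0 < t Q) {Qs : Finset (Fin n → ℝ)}
    (hinj : Set.InjOn (scaledAct g t) (Qs : Set (Fin n → ℝ))) (m : (Fin n → ℝ) → ℕ)
    (F : LocalField n) :
    localAct g (F / ∏ Q ∈ Qs, linForm Q ^ m Q) =
      ((∏ Q ∈ Qs, (t Q : ℂ) ^ m Q) • localAct g F) /
        ∏ Q ∈ Qs.image (scaledAct g t), linForm Q ^ transportExp g t Qs m Q := by
  have hp : (∏ Q ∈ Qs, (t Q : ℂ) ^ m Q) ≠ 0 :=
    Finset.prod_ne_zero_iff.2 fun Q _ => pow_ne_zero _ (Complex.ofReal_ne_zero.2 (ht _).ne')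
  rw [prod_linForm_transportExp hinj, map_div₀, div_eq_mul_inv, div_eq_mul_inv, inv_smul_localField,
    smul_mul_smul_comm, mul_inv_cancel₀ hp, one_smul]

open Classical in
theorem IsDegreePart.localAct {g : Matrix.orthogonalGroup (Fin n) ℝ} {t : (Fin n → ℝ) → ℝ}
    (ht : ∀ Q, 0 < t Q) {Qs : Finset (Fin n → ℝ)}
    (hinj : Set.InjOn (scaledAct g t) (Qs : Set (Fin n → ℝ))) {d : ℤ} {F G : LocalField n}
    (h : IsDegreePart Qs d F G) :
    IsDegreePart (Qs.image (scaledAct g t)) d (localAct g F) (localAct g G) := by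
  obtain ⟨f, m, k, rfl, hk, rfl⟩ := h
  have hmap : ∀ f : MvPowerSeries (Fin n) ℂ, (∏ Q ∈ Qs, (t Q : ℂ) ^ m Q) •
      JK.localAct g (algebraMap _ (LocalField n) f) = algebraMap _ (LocalField n)
        ((∏ Q ∈ Qs, (t Q : ℂ) ^ m Q) • seriesSubst
          ((g⁻¹ : Matrix.orthogonalGroup (Fin n) ℝ) : Matrix (Fin n) (Fin n) ℝ) f) := by
    intro f
    rw [localAct_algebraMap]
    exact ((IsScalarTower.toAlgHom ℂ (MvPowerSeries (Fin n) ℂ)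
      (LocalField n)).toLinearMap.map_smul _ _).symm
  refine ⟨(∏ Q ∈ Qs, (t Q : ℂ) ^ m Q) • seriesSubst
      ((g⁻¹ : Matrix.orthogonalGroup (Fin n) ℝ) : Matrix (Fin n) (Fin n) ℝ) f,
    transportExp g t Qs m, (∏ Q ∈ Qs, (t Q : ℂ) ^ m Q) • seriesSubst
      ((g⁻¹ : Matrix.orthogonalGroup (Fin n) ℝ) : Matrix (Fin n) (Fin n) ℝ) k, ?_, ?_, ?_⟩
  · rw [localAct_div_prod ht hinj, hmap]
  · intro e
    rw [sum_transportExp hinj, MvPowerSeries.coeff_smul, MvPowerSeries.coeff_smul,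
      coeff_seriesSubst_of_homogeneousPart _ hk e]
    split_ifs <;> simp
  · rw [localAct_div_prod ht hinj, hmap]

theorem mem_bases {Qs : Finset (Fin n → ℝ)} {σ : Fin n → Fin n → ℝ} :
    σ ∈ bases Qs ↔ (∀ i, σ i ∈ Qs) ∧ LinearIndependent ℝ σ := by
  simp [bases]

open Classical in
theorem bases_image_scaledAct {g : Matrix.orthogonalGroup (Fin n) ℝ} {t : (Fin n → ℝ) → ℝ}
    (ht : ∀ Q, 0 < t Q) (Qs : Finset (Fin n → ℝ)) :
    bases (Qs.image (scaledAct g t)) = (bases Qs).image fun σ i => scaledAct g t (σ i) := by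
  ext σ
  simp only [Finset.mem_image, mem_bases]
  constructor
  · rintro ⟨h1, h2⟩
    choose τ hτ hτσ using h1
    obtain rfl : (fun i => scaledAct g t (τ i)) = σ := funext hτσ
    exact ⟨τ, ⟨hτ, (linearIndependent_scaledAct_iff g ht τ).1 h2⟩, rfl⟩
  · rintro ⟨τ, ⟨h1, h2⟩, rfl⟩
    exact ⟨fun i => ⟨τ i, h1 i, rfl⟩, (linearIndependent_scaledAct_iff g ht τ).2 h2⟩

open Classical in
theorem localAct_mem_NS {g : Matrix.orthogonalGroup (Fin n) ℝ} {t : (Fin n → ℝ) → ℝ}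
    (ht : ∀ Q, 0 < t Q) {Qs : Finset (Fin n → ℝ)}
    (hinj : Set.InjOn (scaledAct g t) (Qs : Set (Fin n → ℝ))) {F : LocalField n}
    (hF : F ∈ NS Qs) : localAct g F ∈ NS (Qs.image (scaledAct g t)) := by
  have hle : NS Qs ≤ (NS (Qs.image (scaledAct g t))).comap (localAct g).toLinearMap := by
    refine Submodule.span_le.2 ?_
    rintro _ ⟨κ, hκ, hb, ν, d, ψ, hψ, hd, rfl⟩
    have hinjκ : Set.InjOn (scaledAct g t) (κ : Set (Fin n → ℝ)) :=
      hinj.mono (Finset.coe_subset.2 hκ)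
    refine Submodule.subset_span ⟨κ.image (scaledAct g t), Finset.image_subset_image hκ, ?_,
      transportExp g t κ ν, d, (∏ Q ∈ κ, (t Q : ℂ) ^ ν Q) • polySubst
        ((g⁻¹ : Matrix.orthogonalGroup (Fin n) ℝ) : Matrix (Fin n) (Fin n) ℝ) ψ, ?_, ?_, ?_⟩
    · rw [bases_image_scaledAct ht, hb, Finset.image_empty]
    · refine (MvPolynomial.homogeneousSubmodule (Fin n) ℂ d).smul_mem _ ?_
      have h := hψ.aeval _ (isHomogeneous_row
        ((g⁻¹ : Matrix.orthogonalGroup (Fin n) ℝ) : Matrix (Fin n) (Fin n) ℝ))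
      rw [one_mul] at h
      exact h
    · rw [sum_transportExp hinjκ, hd]
    · rw [AlgHom.toLinearMap_apply, localAct_div_prod ht hinjκ, localAct_ofPoly, ofPoly_smul]
  exact hle hF

open Classical in
theorem IsResidue.localAct {g : Matrix.orthogonalGroup (Fin n) ℝ} {t : (Fin n → ℝ) → ℝ}
    (ht : ∀ Q, 0 < t Q) {Qs : Finset (Fin n → ℝ)}
    (hinj : Set.InjOn (scaledAct g t) (Qs : Set (Fin n → ℝ))) {η : Fin n → ℝ}
    {F : LocalField n} {c : ℂ} (h : IsResidue Qs η F c) :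
    IsResidue (Qs.image (scaledAct g t)) (actReal g η) (localAct g F) c := by
  obtain ⟨G, a, hG, hNS, hc⟩ := h
  have hinj' : Set.InjOn (fun (σ : Fin n → Fin n → ℝ) i => scaledAct g t (σ i))
      (bases Qs : Set (Fin n → Fin n → ℝ)) := fun σ hσ τ hτ h => funext fun i =>
    hinj ((mem_bases.1 hσ).1 i) ((mem_bases.1 hτ).1 i) (congrFun h i)
  -- The coefficient of the moved basis is the old one times the product of the scaling factors.
  let b : (Fin n → Fin n → ℝ) → ℂ := fun σ => a σ * ∏ i, (t (σ i) : ℂ)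
  let a' : (Fin n → Fin n → ℝ) → ℂ := fun σ =>
    b (Function.invFunOn (fun (σ : Fin n → Fin n → ℝ) i => scaledAct g t (σ i))
      (bases Qs : Set (Fin n → Fin n → ℝ)) σ)
  have ha' : ∀ σ ∈ bases Qs, a' (fun i => scaledAct g t (σ i)) = b σ := fun σ hσ =>
    congrArg b (hinj'.leftInvOn_invFunOn (Finset.mem_coe.2 hσ))
  refine ⟨JK.localAct g G, a', hG.localAct ht hinj, ?_, ?_⟩
  · have h1 : ∑ σ ∈ bases (Qs.image (scaledAct g t)), a' σ • basicFraction σ =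
        JK.localAct g (∑ σ ∈ bases Qs, a σ • basicFraction σ) := by
      rw [bases_image_scaledAct ht, Finset.sum_image hinj', map_sum]
      exact Finset.sum_congr rfl fun σ hσ => by
        rw [ha' σ hσ, map_smul, localAct_basicFraction g ht, smul_smul]
    rw [h1, ← map_sub]
    exact localAct_mem_NS ht hinj hNS
  · rw [hc, bases_image_scaledAct ht, Finset.sum_image hinj']
    exact Finset.sum_congr rfl fun σ hσ => by
      rw [ha' σ hσ, mul_assoc, basicResidue_scaledAct g ht]

/-! ### The vectors at a point and at its image -/

theorem dotProduct_actReal_actComplex (g : Matrix.orthogonalGroup (Fin n) ℝ) (Q : Fin n → ℝ)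
    (φ : Fin n → ℂ) :
    ∑ j, (actReal g Q j : ℂ) * actComplex g φ j = ∑ j, (Q j : ℂ) * φ j := by
  have h0 : (fun j => (actReal g Q j : ℂ)) =
      (g : Matrix (Fin n) (Fin n) ℝ).map Complex.ofReal *ᵥ fun j => (Q j : ℂ) := by
    funext j
    simp [actReal, Matrix.mulVec, dotProduct]
  have h1 : ((g : Matrix (Fin n) (Fin n) ℝ).map Complex.ofReal)ᵀ *
      (g : Matrix (Fin n) (Fin n) ℝ).map Complex.ofReal = 1 := by
    have h := congrArg (fun M : Matrix (Fin n) (Fin n) ℝ => M.map Complex.ofRealHom)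
      ((Matrix.mem_orthogonalGroup_iff' (Fin n) ℝ).1 g.2)
    simp only [Matrix.map_mul] at h
    rw [Matrix.map_one _ (map_zero _) (map_one _)] at h
    exact h
  change (fun j => (actReal g Q j : ℂ)) ⬝ᵥ actComplex g φ = (fun j => (Q j : ℂ)) ⬝ᵥ φ
  rw [h0, actComplex, Matrix.dotProduct_mulVec, Matrix.vecMul_mulVec, h1, Matrix.vecMul_one]

theorem mem_vectorsAt {A : Finset ((Fin n → ℝ) × ℂ)} {φ : Fin n → ℂ} {Q : Fin n → ℝ} :
    Q ∈ vectorsAt A φ ↔ ∃ c, (Q, c) ∈ A ∧ φ ∈ hyperplane (Q, c) := by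
  simp [vectorsAt]

/-- An element `g` of `W` moves the vectors at `φ` to the vectors at `gφ`, up to positive factors,
and does not identify any two of them.

Injectivity rests on the distinctness of the hyperplanes: if `Q₁` and `Q₂` have the same image, then
`Q₁` and `Q₂` are proportional, so the two forms, both vanishing at `φ`, have the same zero set. The
image is everything because `g⁻¹` moves a vector at `gφ` back to a multiple of one at `φ`. -/
theorem exists_vectorsAt_eq_image [DecidableEq (Fin n → ℝ)]
    {W : Subgroup (Matrix.orthogonalGroup (Fin n) ℝ)}
    {A : Finset ((Fin n → ℝ) × ℂ)} (hdist : Set.InjOn hyperplane (A : Set ((Fin n → ℝ) × ℂ)))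
    (hAW : Equivariant W A) {g : Matrix.orthogonalGroup (Fin n) ℝ} (hg : g ∈ W) (φ : Fin n → ℂ) :
    ∃ t : (Fin n → ℝ) → ℝ, (∀ Q, 0 < t Q) ∧
      Set.InjOn (scaledAct g t) (vectorsAt A φ : Set (Fin n → ℝ)) ∧
      vectorsAt A (actComplex g φ) = (vectorsAt A φ).image (scaledAct g t) := by
  -- Parallel vectors at the same point coincide.
  have hpar : ∀ (ψ : Fin n → ℂ) (s : ℝ) (Q : Fin n → ℝ), s ≠ 0 → Q ∈ vectorsAt A ψ →
      s • Q ∈ vectorsAt A ψ → s • Q = Q := by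
    intro ψ s Q hs hQ hsQ
    obtain ⟨c, hcA, hc⟩ := mem_vectorsAt.1 hQ
    obtain ⟨c', hcA', hc'⟩ := mem_vectorsAt.1 hsQ
    have hsum : ∀ χ : Fin n → ℂ, ∑ j, (((s • Q) j : ℝ) : ℂ) * χ j = s * ∑ j, (Q j : ℂ) * χ j := by
      intro χ
      rw [Finset.mul_sum]
      exact Finset.sum_congr rfl fun j _ => by simp [mul_assoc]
    have hcc : c' = s * c := by
      simp only [hyperplane, Set.mem_ofPred_eq, hsum] at hc hc'
      linear_combination hc' - (s : ℂ) * hc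
    have hhyp : hyperplane (s • Q, c') = hyperplane (Q, c) := by
      ext χ
      simp only [hyperplane, Set.mem_ofPred_eq, hsum, hcc]
      rw [← mul_add, mul_eq_zero, or_iff_right (Complex.ofReal_ne_zero.2 hs)]
    exact congrArg Prod.fst (hdist hcA' hcA hhyp)
  -- Every element of `W` moves a vector at a point to a multiple of a vector at the image point.
  have hmove : ∀ h ∈ W, ∀ (ψ : Fin n → ℂ) (Q : Fin n → ℝ), Q ∈ vectorsAt A ψ →
      ∃ s : ℝ, 0 < s ∧ s • actReal h Q ∈ vectorsAt A (actComplex h ψ) := by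
    intro h hh ψ Q hQ
    obtain ⟨c, hcA, hc⟩ := mem_vectorsAt.1 hQ
    obtain ⟨s, hs, hsA⟩ := hAW h hh _ hcA
    refine ⟨s, hs, mem_vectorsAt.2 ⟨_, hsA, ?_⟩⟩
    have hd := dotProduct_actReal_actComplex h Q ψ
    simp only [hyperplane, Set.mem_ofPred_eq, Pi.smul_apply, smul_eq_mul, Complex.ofReal_mul,
      mul_assoc, ← Finset.mul_sum, ← mul_add] at hc ⊢
    rw [hd, hc, mul_zero]
  have hex : ∀ Q : Fin n → ℝ, ∃ s : ℝ, 0 < s ∧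
      (Q ∈ vectorsAt A φ → s • actReal g Q ∈ vectorsAt A (actComplex g φ)) := by
    intro Q
    by_cases hQ : Q ∈ vectorsAt A φ
    · obtain ⟨s, hs, h⟩ := hmove g hg φ Q hQ
      exact ⟨s, hs, fun _ => h⟩
    · exact ⟨1, one_pos, fun h => absurd h hQ⟩
  choose t ht hmem using hex
  have hsmul : ∀ (h : Matrix.orthogonalGroup (Fin n) ℝ) (s : ℝ) (v : Fin n → ℝ),
      actReal h (s • v) = s • actReal h v := fun h s v => Matrix.mulVec_smul _ s v
  refine ⟨t, ht, ?_, ?_⟩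
  · intro Q₁ hQ₁ Q₂ hQ₂ heq
    have h12 : Q₁ = ((t Q₁)⁻¹ * t Q₂) • Q₂ := by
      apply actReal_injective g
      rw [hsmul, mul_smul, eq_inv_smul_iff₀ (ht Q₁).ne']
      exact heq
    have hpos := mul_pos (inv_pos.2 (ht Q₁)) (ht Q₂)
    rw [h12]
    exact hpar φ _ Q₂ hpos.ne' hQ₂ (h12 ▸ hQ₁)
  · ext P
    rw [Finset.mem_image]
    constructor
    · intro hP
      obtain ⟨s, hs, hsP⟩ := hmove g⁻¹ (W.inv_mem hg) _ P hP
      rw [actComplex_inv_actComplex] at hsP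
      refine ⟨_, hsP, ?_⟩
      have hval : scaledAct g t (s • actReal g⁻¹ P) = (t (s • actReal g⁻¹ P) * s) • P := by
        rw [scaledAct, hsmul, ← actReal_mul, mul_inv_cancel, actReal_one, smul_smul]
      rw [hval]
      refine hpar _ _ P (mul_pos (ht _) hs).ne' hP ?_
      rw [← hval]
      exact hmem _ hsP
    · rintro ⟨Q, hQ, rfl⟩
      exact hmem Q hQ

/-- The residues of `Z` at `φ` are residues of `Z` at `gφ`. -/
theorem isResidue_actComplex {W : Subgroup (Matrix.orthogonalGroup (Fin n) ℝ)} {Z : RatFun n}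
    (hZ : ∀ g ∈ W, precomp g Z = Z) {A : Finset ((Fin n → ℝ) × ℂ)}
    (hdist : Set.InjOn hyperplane (A : Set ((Fin n → ℝ) × ℂ))) (hAW : Equivariant W A)
    {g : Matrix.orthogonalGroup (Fin n) ℝ} (hg : g ∈ W) {φ : Fin n → ℂ} {η : Fin n → ℝ} {c : ℂ}
    (h : IsResidue (vectorsAt A φ) η (expandAt φ Z) c) :
    IsResidue (vectorsAt A (actComplex g φ)) (actReal g η) (expandAt (actComplex g φ) Z) c := by
  classical
  obtain ⟨t, ht, hinj, hV⟩ := exists_vectorsAt_eq_image hdist hAW hg φ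
  rw [expandAt_actComplex, hZ g hg, hV]
  convert h.localAct ht hinj

/-- The residue depends only on the set of values `c` that satisfy `IsResidue`. -/
theorem residue_congr {Qs Qs' : Finset (Fin n → ℝ)} {η η' : Fin n → ℝ} {F F' : LocalField n}
    (h : ∀ c, IsResidue Qs' η' F' c ↔ IsResidue Qs η F c) :
    residue Qs' η' F' = residue Qs η F := by
  have h' : IsResidue Qs' η' F' = IsResidue Qs η F := funext fun c => propext (h c)
  have key : ∀ P P' : ℂ → Prop, P' = P → (open Classical in
      if h : ∃ c, P' c then h.choose else 0) = (open Classical in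
      if h : ∃ c, P c then h.choose else 0) := by
    rintro P _ rfl
    rfl
  exact key _ _ h'

end

end JK

theorem mainTheorem4 {n : ℕ} (W : Subgroup (Matrix.orthogonalGroup (Fin n) ℝ))
    (Z : JK.RatFun n) (hZ : ∀ g ∈ W, JK.precomp g Z = Z)
    (A : Finset ((Fin n → ℝ) × ℂ)) (hA : JK.Factorizes A Z) (hAW : JK.Equivariant W A)
    (φ : Fin n → ℂ) (η : Fin n → ℝ)
    (hproj : JK.Projective (JK.vectorsAt A φ)) (hgen : JK.Generic (JK.vectorsAt A φ) η)
    (g : Matrix.orthogonalGroup (Fin n) ℝ) (hg : g ∈ W) :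
    JK.JKRes A (JK.actReal g η) (JK.actComplex g φ) Z = JK.JKRes A η φ Z := by
  refine JK.residue_congr fun c => ⟨fun h => ?_, JK.isResidue_actComplex hZ hA.distinct hAW hg⟩
  have h' := JK.isResidue_actComplex hZ hA.distinct hAW (W.inv_mem hg) h
  rwa [JK.actComplex_inv_actComplex, ← JK.actReal_mul, inv_mul_cancel, JK.actReal_one] at h'
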